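/- Let $\mathcal K$ be a field and let $\Gamma$ be a finite connected quiver without oriented cycles (connected: the underlying undirected graph is connected) whose path algebra $\mathcal K\Gamma$ is finite-dimensional. Let $\mathscr P$ be the set of all paths of $\Gamma$, including the trivial paths $e_i$ ($i$ a vertex), and write $s(p)$, $e(p)$ for the start and the end of a path $p$. The product $xy$ of two paths is the path "first $y$, then $x$" if $e(y)=s(x)$, and $0$ otherwise. A linear map $\Theta:\mathcal K\Gamma\to\mathcal K\Gamma$ is a Lie derivation, i.e. $\Theta([a,b])=[\Theta(a),b]+[a,\Theta(b)]$ for all $a,b$ with $[a,b]=ab-ba$, if and only if there are scalars $k_i\in\mathcal K$ ($i$ a vertex) and $k_q^p\in\mathcal K$ ($p,q\in\mathscr P$; for a vertex $i$ we write $k_q^i:=k_q^{e_i}$) such that (1) for every vertex $i$, $$\Theta(e_i)=k_i\cdot 1+\sum_{\substack{q\in\mathscr P,\ s(q)\ne e(q)\\ s(q)=i\text{ or }e(q)=i}}k_q^{e_i}\,q;$$ (2) for every nontrivial path $p$, $$\Theta(p)=\sum_{\substack{q\in\mathscr P,\ s(q)\neq e(q)\\ e(q)=s(p)}}k_q^{s(p)}\,pq+\sum_{\substack{q\in\mathscr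 P,\ s(q)=s(p)\\ e(q)=e(p)}}k_q^p\,q+\sum_{\substack{q\in\mathscr P,\ s(q)\neq e(q)\\ s(q)=e(p)}}k_q^{e(p)}\,qp;$$ and the coefficients satisfy the following two conditions: (i) $k_q^{s(q)}+k_q^{e(q)}=0$ for every path $q$ with $s(q)\ne e(q)$; (ii) for all nontrivial paths $x,y$ with $e(y)=s(x)$ and every path $w$ parallel to $xy$ (same start and same end), $$k_w^{xy}=\sum_{\substack{q\text{ parallel to }x\\ qy=w}}k_q^x+\sum_{\substack{q\text{ parallel to }y\\ xq=w}}k_q^y .$$ -/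

import Mathlib

/-- A path of a quiver with its endpoints bundled: `src` is the start `s(p)`, `tgt` is the end
`e(p)`. Trivial paths (`Quiver.Path.nil`) are included. -/
structure QPath (V : Type*) [Quiver V] where
  src : V
  tgt : V
  path : Quiver.Path src tgt

namespace QPath

variable {V : Type*} [Quiver V]

/-- The trivial path at the vertex `i`. -/
def triv (i : V) : QPath V := ⟨i, i, Quiver.Path.nil⟩

/-- A path is nontrivial if it contains at least one arrow. -/
def IsNontrivial (p : QPath V) : Prop := 0 < p.path.length

/-- Two paths are parallel if they have the same start and the same end. -/
def Parallel (q p : QPath V) : Prop := q.src = p.src ∧ q.tgt = p.tgt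

/-- The composite path `x y`: first run through `y`, then through `x`. -/
def mul (x y : QPath V) (h : y.tgt = x.src) : QPath V :=
  ⟨y.src, x.tgt, (y.path.cast rfl h).comp x.path⟩

end QPath

/-- A quiver has no oriented cycles: no nontrivial path has the same start and end. -/
def Quiver.NoOrientedCycles (V : Type*) [Quiver V] : Prop :=
  ∀ p : QPath V, p.IsNontrivial → p.src ≠ p.tgt

/-- A quiver is connected (its underlying undirected graph is): any two vertices are joined by a
path in the symmetrized quiver. -/
def Quiver.IsWeaklyConnected (V : Type*) [Quiver V] : Prop :=
  ∀ a b : V, (a : Quiver.WeaklyConnectedComponent V) = b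

/-- The path algebra: the vector space with basis the set of all paths. -/
def PathAlgebra (K : Type*) [Field K] (V : Type*) [Quiver V] : Type _ := QPath V →₀ K

namespace PathAlgebra

variable {K : Type*} [Field K] {V : Type*} [Quiver V]

noncomputable instance : AddCommGroup (PathAlgebra K V) :=
  inferInstanceAs (AddCommGroup (QPath V →₀ K))

noncomputable instance : Module K (PathAlgebra K V) :=
  inferInstanceAs (Module K (QPath V →₀ K))

variable (K) in
/-- A path, as an element of the path algebra. -/
noncomputable def ofPath (p : QPath V) : PathAlgebra K V := Finsupp.single p (1 : K)

variable (K V) in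
/-- The basis of the path algebra given by the paths. -/
noncomputable def basis : Module.Basis (QPath V) K (PathAlgebra K V) :=
  Module.Basis.ofRepr (LinearEquiv.refl K (QPath V →₀ K))

theorem basis_apply (p : QPath V) : basis K V p = ofPath K p := rfl

open Classical in
variable (K) in
/-- The product of two paths: the composite `x y` if `e(y) = s(x)`, and zero otherwise. -/
noncomputable def pathMul (x y : QPath V) : PathAlgebra K V :=
  if h : y.tgt = x.src then ofPath K (x.mul y h) else 0

variable (K V) in
/-- The multiplication of the path algebra: the bilinear extension of the product of paths. -/
noncomputable def mulHom : PathAlgebra K V →ₗ[K] PathAlgebra K V →ₗ[K] PathAlgebra K V :=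
  (basis K V).constr K fun x => (basis K V).constr K fun y => pathMul K x y

noncomputable instance : Mul (PathAlgebra K V) := ⟨fun a b => mulHom K V a b⟩

theorem mul_def (a b : PathAlgebra K V) : a * b = mulHom K V a b := rfl

theorem ofPath_mul_ofPath (x y : QPath V) : ofPath K x * ofPath K y = pathMul K x y := by
  rw [mul_def, ← basis_apply, ← basis_apply, mulHom, Module.Basis.constr_basis,
    Module.Basis.constr_basis]

theorem ofPath_mul_of_eq (x y : QPath V) (h : y.tgt = x.src) :
    ofPath K x * ofPath K y = ofPath K (x.mul y h) := by
  rw [ofPath_mul_ofPath, pathMul, dif_pos h]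

theorem ofPath_mul_of_ne (x y : QPath V) (h : y.tgt ≠ x.src) :
    ofPath K x * ofPath K y = 0 := by
  rw [ofPath_mul_ofPath, pathMul, dif_neg h]

theorem zero_mul_aux (a : PathAlgebra K V) : 0 * a = 0 := by simp [mul_def]

theorem mul_zero_aux (a : PathAlgebra K V) : a * 0 = 0 := by simp [mul_def]

theorem ofPath_mul_assoc (x y z : QPath V) :
    ofPath K x * ofPath K y * ofPath K z = ofPath K x * (ofPath K y * ofPath K z) := by
  by_cases h : y.tgt = x.src
  · rw [ofPath_mul_of_eq x y h]
    by_cases h' : z.tgt = y.src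
    · rw [ofPath_mul_of_eq y z h', ofPath_mul_of_eq (x.mul y h) z h',
        ofPath_mul_of_eq x (y.mul z h') h]
      obtain ⟨xs, xt, x⟩ := x
      obtain ⟨ys, yt, y⟩ := y
      obtain ⟨zs, zt, z⟩ := z
      simp only at h h'
      subst h h'
      simp [QPath.mul, Quiver.Path.comp_assoc]
    · rw [ofPath_mul_of_ne y z h', ofPath_mul_of_ne (x.mul y h) z h', mul_zero_aux]
  · rw [ofPath_mul_of_ne x y h, zero_mul_aux]
    by_cases h' : z.tgt = y.src
    · rw [ofPath_mul_of_eq y z h', ofPath_mul_of_ne x (y.mul z h') h]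
    · rw [ofPath_mul_of_ne y z h', mul_zero_aux]

theorem induction_ofPath {P : PathAlgebra K V → Prop} (a : PathAlgebra K V) (zero : P 0)
    (add : ∀ x y, P x → P y → P (x + y)) (smul : ∀ (c : K) (p : QPath V), P (c • ofPath K p)) :
    P a := by
  refine Finsupp.induction_linear (motive := P) a zero add fun p c => ?_
  have h : (Finsupp.single p c : QPath V →₀ K) = c • Finsupp.single p (1 : K) := by simp
  have := smul c p
  rw [ofPath] at this
  erw [h]
  exact this

theorem mul_assoc_aux (a b c : PathAlgebra K V) : a * b * c = a * (b * c) := by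
  induction a using induction_ofPath with
  | zero => simp [mul_def]
  | add x y hx hy => simp only [mul_def, map_add, LinearMap.add_apply] at *; rw [hx, hy]
  | smul r p =>
  induction b using induction_ofPath with
  | zero => simp [mul_def]
  | add x y hx hy => simp only [mul_def, map_add, LinearMap.add_apply] at *; rw [hx, hy]
  | smul s q =>
  induction c using induction_ofPath with
  | zero => simp [mul_def]
  | add x y hx hy => simp only [mul_def, map_add] at *; rw [hx, hy]
  | smul t w =>
    have h := ofPath_mul_assoc (K := K) p q w
    simp only [mul_def, map_smul, LinearMap.smul_apply] at *
    rw [h]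

/-- The identity of the path algebra: the sum of all trivial paths. -/
noncomputable instance [Fintype V] : One (PathAlgebra K V) := ⟨∑ i : V, ofPath K (QPath.triv i)⟩

theorem one_def [Fintype V] : (1 : PathAlgebra K V) = ∑ i : V, ofPath K (QPath.triv i) := rfl

theorem one_mul_ofPath [Fintype V] (p : QPath V) : 1 * ofPath K p = ofPath K p := by
  classical
  have h : ∀ i : V, ofPath K (QPath.triv i) * ofPath K p =
      if p.tgt = i then ofPath K p else 0 := by
    intro i
    split_ifs with hi
    · subst hi
      rw [ofPath_mul_of_eq _ _ rfl]
      rfl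
    · exact ofPath_mul_of_ne _ _ hi
  simp only [mul_def] at h
  simp only [one_def, mul_def, map_sum, LinearMap.sum_apply, h]
  simp

theorem ofPath_mul_one [Fintype V] (p : QPath V) : ofPath K p * 1 = ofPath K p := by
  classical
  have h : ∀ i : V, ofPath K p * ofPath K (QPath.triv i) =
      if i = p.src then ofPath K p else 0 := by
    intro i
    split_ifs with hi
    · subst hi
      rw [ofPath_mul_of_eq _ _ rfl]
      simp [QPath.mul, QPath.triv]
    · exact ofPath_mul_of_ne _ _ hi
  simp only [mul_def] at h
  simp only [one_def, mul_def, map_sum, h]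
  simp

noncomputable instance [Fintype V] : Ring (PathAlgebra K V) :=
  { (inferInstance : AddCommGroup (PathAlgebra K V)),
    (inferInstance : Mul (PathAlgebra K V)),
    (inferInstance : One (PathAlgebra K V)) with
    left_distrib := fun a b c => by simp [mul_def]
    right_distrib := fun a b c => by simp [mul_def]
    zero_mul := zero_mul_aux
    mul_zero := mul_zero_aux
    mul_assoc := mul_assoc_aux
    one_mul := fun a => by
      induction a using induction_ofPath with
      | zero => exact mul_zero_aux _
      | add x y hx hy => simp only [mul_def, map_add] at *; rw [hx, hy]
      | smul r p =>
        have h := one_mul_ofPath (K := K) p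
        simp only [mul_def, map_smul] at *
        rw [h]
    mul_one := fun a => by
      induction a using induction_ofPath with
      | zero => exact zero_mul_aux _
      | add x y hx hy => simp only [mul_def, map_add, LinearMap.add_apply] at *; rw [hx, hy]
      | smul r p =>
        have h := ofPath_mul_one (K := K) p
        simp only [mul_def, map_smul, LinearMap.smul_apply] at *
        rw [h] }

noncomputable instance [Fintype V] : Algebra K (PathAlgebra K V) :=
  Algebra.ofModule (fun r x y => by simp [mul_def]) (fun r x y => by simp [mul_def])

/-- If the path algebra is finite-dimensional there are only finitely many paths, so that the sums
over sets of paths below are finite sums. -/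
theorem finite_qpath (K : Type*) [Field K] (V : Type*) [Quiver V]
    [FiniteDimensional K (PathAlgebra K V)] : Finite (QPath V) :=
  Module.Finite.finite_basis (basis K V)

end PathAlgebra

/-- A linear map `Θ` of an algebra into itself is a Lie derivation if
`Θ([a, b]) = [Θ(a), b] + [a, Θ(b)]` for all `a`, `b`, where `[a, b] = a b - b a`. -/
def IsLieDerivation {R A : Type*} [CommRing R] [Ring A] [Algebra R A] (Θ : A →ₗ[R] A) : Prop :=
  ∀ a b : A, Θ (a * b - b * a) = (Θ a * b - b * Θ a) + (a * Θ b - Θ b * a)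

/-- The conditions on a family of coefficients `c p q` (the coefficient of the path `q` attached to
the path `p`; for `p` the trivial path at `i` it is the one attached to the vertex `i`). -/
structure IsDerivationCoeff {K : Type*} [Field K] {V : Type*} [Quiver V]
    (c : QPath V → QPath V → K) : Prop where
  /-- The two coefficients of a path with distinct endpoints attached to its endpoints are
  opposite. -/
  vertex : ∀ q : QPath V, q.src ≠ q.tgt →
    c (QPath.triv q.src) q + c (QPath.triv q.tgt) q = 0
  /-- For composable nontrivial paths `x`, `y` and every path `w` parallel to `x y`, the coefficient
  of `w` attached to `x y` is the sum of all `c x q` with `q` parallel to `x` and `q y = w`, and of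
  all `c y q` with `q` parallel to `y` and `x q = w`. (`Quiver.Path.comp` composes from left to
  right: `y.comp x` is the path `x y`.) -/
  path : ∀ (i j l : V) (y : Quiver.Path i j) (x : Quiver.Path j l) (w : Quiver.Path i l),
    0 < y.length → 0 < x.length →
    c ⟨i, l, y.comp x⟩ ⟨i, l, w⟩ =
      (∑ᶠ (q : Quiver.Path j l) (_ : y.comp q = w), c ⟨j, l, x⟩ ⟨j, l, q⟩) +
      (∑ᶠ (q : Quiver.Path i j) (_ : q.comp x = w), c ⟨i, j, y⟩ ⟨i, j, q⟩)

/-!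
Given coefficients `c`, put `u = ∑ c (e_{s(q)}) q • q` over the paths `q` with `s(q) ≠ e(q)`. Under
the vertex condition on `c`, the two formulas of the theorem say exactly that
`Θ = τ + [u, ·] + E`, where `τ` sends `e_i` to `k i • 1` and kills the nontrivial paths, and `E`
kills the trivial paths and sends a nontrivial path `p` to `∑ c p q • q` over the `q` parallel to
`p` (`forall_ofPath_eq_iff`).

Each summand is a Lie derivation: `τ` because its values are central and it vanishes on commutators
(`isLieDerivation_trivialPart`), `[u, ·]` always, and `E` because the path condition on `c` is its
Leibniz rule on composable nontrivial paths (`parallelPart_leibniz_iff`).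

Conversely, let `Θ` be a Lie derivation. Applying it to `[e_i, e_j] = 0` determines the coefficients
in `Θ e_i` of the paths with distinct endpoints, up to the vertex condition; applying it to
`[e_i, a]` for an arrow `a` shows that the coefficients of `Θ e_i` at the trivial paths agree along
arrows, hence are all equal by connectedness. So `Θ` agrees with some `τ + [u, ·]` on the trivial
paths (`apply_triv_eq`). The difference `Φ` is a Lie derivation killing the trivial paths, and
applying it to `[e_i, p]` shows that `Φ p` involves only paths parallel to `p`
(`parallel_of_coeff_ne_zero`), that is, `Φ = E` for suitable coefficients. As there are no oriented
cycles, `x y = [x, y]` for composable nontrivial paths, so the Lie identity for `E` gives back its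
Leibniz rule and thereby the path condition (`path_of_isLieDerivation_parallelPart`).
-/

/-! ### Paths and connectedness -/

/-- In a weakly connected quiver, a function that agrees on the endpoints of every arrow is
constant. -/
theorem Quiver.IsWeaklyConnected.eq_of_forall_hom {V : Type*} [Quiver V]
    (hconn : Quiver.IsWeaklyConnected V) {α : Type*} {f : V → α}
    (hf : ∀ {i j : V}, (i ⟶ j) → f i = f j) (a b : V) : f a = f b := by
  obtain ⟨p⟩ : Nonempty (@Quiver.Path (Quiver.Symmetrify V) _ a b) := Quotient.exact (hconn a b)
  induction p with
  | nil => rfl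
  | cons p e ih =>
    rw [ih]
    rcases e with e | e
    · exact hf e
    · exact (hf e).symm

namespace QPath

variable {V : Type*} [Quiver V]

theorem eq_triv_of_not_isNontrivial {p : QPath V} (hp : ¬ p.IsNontrivial) :
    p = triv p.src := by
  obtain ⟨i, j, p⟩ := p
  cases p with
  | nil => rfl
  | cons p a => exact absurd (Nat.succ_pos _) hp

theorem not_isNontrivial_triv (i : V) : ¬ (triv i).IsNontrivial := lt_irrefl 0

theorem length_mul (x y : QPath V) (h : y.tgt = x.src) :
    (x.mul y h).path.length = x.path.length + y.path.length := by
  obtain ⟨i, j, x⟩ := x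
  obtain ⟨l, m, y⟩ := y
  obtain rfl : m = i := h
  simp [mul, Quiver.Path.length_comp, add_comm]

theorem mul_isNontrivial_left {x y : QPath V} (h : y.tgt = x.src) (hx : x.IsNontrivial) :
    (x.mul y h).IsNontrivial := by
  unfold IsNontrivial at *
  rw [length_mul]
  omega

theorem mul_isNontrivial_right {x y : QPath V} (h : y.tgt = x.src) (hy : y.IsNontrivial) :
    (x.mul y h).IsNontrivial := by
  unfold IsNontrivial at *
  rw [length_mul]
  omega

/-- Without oriented cycles, the composability of two paths in one order excludes the other order
as soon as one of them is nontrivial. -/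
theorem tgt_ne_src_of_composable (hacyc : Quiver.NoOrientedCycles V) {x y : QPath V}
    (h : y.tgt = x.src) (hx : x.IsNontrivial) : x.tgt ≠ y.src := fun h' =>
  hacyc (x.mul y h) (mul_isNontrivial_left h hx) h'.symm

end QPath

/-! ### Coefficients in the path algebra -/

namespace PathAlgebra

variable {K : Type*} [Field K] {V : Type*} [Quiver V]

theorem linearMap_ext {M : Type*} [AddCommGroup M] [Module K M] {f g : PathAlgebra K V →ₗ[K] M}
    (h : ∀ p, f (ofPath K p) = g (ofPath K p)) : f = g :=
  (basis K V).ext h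

variable (K) in
/-- The coefficient of the path `q` in an element of the path algebra. -/
noncomputable def coeff (q : QPath V) : PathAlgebra K V →ₗ[K] K := (basis K V).coord q

open Classical in
theorem coeff_ofPath (q p : QPath V) : coeff K q (ofPath K p) = if p = q then 1 else 0 := by
  rw [coeff, ← basis_apply, Module.Basis.coord_apply, Module.Basis.repr_self,
    Finsupp.single_apply]

theorem ext_coeff {a b : PathAlgebra K V} (h : ∀ q, coeff K q a = coeff K q b) : a = b :=
  (basis K V).ext_elem h

theorem sum_coeff_smul [Fintype (QPath V)] (a : PathAlgebra K V) :
    ∑ q, coeff K q a • ofPath K q = a :=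
  (basis K V).sum_repr a

open Classical in
theorem ofPath_triv_mul [Fintype V] (i : V) (p : QPath V) :
    ofPath K (QPath.triv i) * ofPath K p = if p.tgt = i then ofPath K p else 0 := by
  split_ifs with hi
  · subst hi
    rw [ofPath_mul_of_eq _ _ rfl]
    rfl
  · exact ofPath_mul_of_ne _ _ hi

open Classical in
theorem ofPath_mul_triv [Fintype V] (i : V) (p : QPath V) :
    ofPath K p * ofPath K (QPath.triv i) = if p.src = i then ofPath K p else 0 := by
  split_ifs with hi
  · subst hi
    rw [ofPath_mul_of_eq _ _ rfl]
    simp [QPath.mul, QPath.triv]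
  · exact ofPath_mul_of_ne _ _ fun h => hi h.symm

/-- Multiplying by a trivial path on the left selects the paths ending at the vertex. -/
theorem coeff_triv_mul [Fintype V] [DecidableEq V] (i : V) (q : QPath V) (a : PathAlgebra K V) :
    coeff K q (ofPath K (QPath.triv i) * a) = if q.tgt = i then coeff K q a else 0 := by
  classical
  induction a using induction_ofPath with
  | zero => simp
  | add x y hx hy => rw [mul_add, map_add, hx, hy, map_add]; split_ifs <;> simp
  | smul r p =>
    rw [mul_smul_comm, ofPath_triv_mul]
    by_cases hpq : p = q
    · subst hpq; split_ifs <;> simp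
    · split_ifs <;> simp [coeff_ofPath, hpq]

/-- Multiplying by a trivial path on the right selects the paths starting at the vertex. -/
theorem coeff_mul_triv [Fintype V] [DecidableEq V] (i : V) (q : QPath V) (a : PathAlgebra K V) :
    coeff K q (a * ofPath K (QPath.triv i)) = if q.src = i then coeff K q a else 0 := by
  classical
  induction a using induction_ofPath with
  | zero => simp
  | add x y hx hy => rw [add_mul, map_add, hx, hy, map_add]; split_ifs <;> simp
  | smul r p =>
    rw [smul_mul_assoc, ofPath_mul_triv]
    by_cases hpq : p = q
    · subst hpq; split_ifs <;> simp
    · split_ifs <;> simp [coeff_ofPath, hpq]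

/-- For length reasons only the trivial path at the end of `p` contributes `p` to `a * p`. -/
theorem coeff_self_mul_ofPath [Fintype V] (p : QPath V) (a : PathAlgebra K V) :
    coeff K p (a * ofPath K p) = coeff K (QPath.triv p.tgt) a := by
  classical
  induction a using induction_ofPath with
  | zero => simp
  | add x y hx hy => rw [add_mul, map_add, hx, hy, map_add]
  | smul r q =>
    rw [smul_mul_assoc, map_smul, map_smul]
    congr 1
    by_cases hq : q = QPath.triv p.tgt
    · subst hq; simp [ofPath_triv_mul, coeff_ofPath]
    · rw [coeff_ofPath, if_neg hq]
      by_cases h : p.tgt = q.src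
      · rw [ofPath_mul_of_eq _ _ h, coeff_ofPath, if_neg]
        intro he
        have hl := congrArg (fun r : QPath V => r.path.length) he
        simp only [QPath.length_mul] at hl
        refine hq ?_
        rw [h]
        exact QPath.eq_triv_of_not_isNontrivial (by unfold QPath.IsNontrivial; omega)
      · rw [ofPath_mul_of_ne _ _ h, map_zero]

theorem coeff_self_ofPath_mul [Fintype V] (p : QPath V) (a : PathAlgebra K V) :
    coeff K p (ofPath K p * a) = coeff K (QPath.triv p.src) a := by
  classical
  induction a using induction_ofPath with
  | zero => simp
  | add x y hx hy => rw [mul_add, map_add, hx, hy, map_add]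
  | smul r q =>
    rw [mul_smul_comm, map_smul, map_smul]
    congr 1
    by_cases hq : q = QPath.triv p.src
    · subst hq; simp [ofPath_mul_triv, coeff_ofPath]
    · rw [coeff_ofPath, if_neg hq]
      by_cases h : q.tgt = p.src
      · rw [ofPath_mul_of_eq _ _ h, coeff_ofPath, if_neg]
        intro he
        have hl := congrArg (fun r : QPath V => r.path.length) he
        simp only [QPath.length_mul] at hl
        have hq' := QPath.eq_triv_of_not_isNontrivial (p := q)
          (by unfold QPath.IsNontrivial; omega)
        refine hq ?_
        rw [← h]
        rw [hq']
        rfl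
      · rw [ofPath_mul_of_ne _ _ h, map_zero]

end PathAlgebra

/-! ### Lie derivations of an algebra -/

section LieDerivation

variable {R A : Type*} [CommRing R] [Ring A] [Algebra R A]

theorem IsLieDerivation.add {Θ Φ : A →ₗ[R] A} (hΘ : IsLieDerivation Θ) (hΦ : IsLieDerivation Φ) :
    IsLieDerivation (Θ + Φ) := fun a b => by
  rw [LinearMap.add_apply, hΘ, hΦ]
  simp only [LinearMap.add_apply, add_mul, mul_add]
  abel

theorem IsLieDerivation.sub {Θ Φ : A →ₗ[R] A} (hΘ : IsLieDerivation Θ) (hΦ : IsLieDerivation Φ) :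
    IsLieDerivation (Θ - Φ) := fun a b => by
  rw [LinearMap.sub_apply, hΘ, hΦ]
  simp only [LinearMap.sub_apply, sub_mul, mul_sub]
  abel

variable (R) in
/-- The inner derivation `x ↦ u x - x u`. -/
noncomputable def innerDerivation (u : A) : A →ₗ[R] A :=
  LinearMap.mulLeft R u - LinearMap.mulRight R u

theorem innerDerivation_apply (u x : A) : innerDerivation R u x = u * x - x * u := rfl

theorem isLieDerivation_innerDerivation (u : A) : IsLieDerivation (innerDerivation R u) :=
  fun a b => by
    simp only [innerDerivation_apply]
    noncomm_ring

theorem isLieDerivation_of_leibniz {Θ : A →ₗ[R] A} (h : ∀ a b, Θ (a * b) = Θ a * b + a * Θ b) :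
    IsLieDerivation Θ := fun a b => by
  rw [map_sub, h, h]
  abel

end LieDerivation

/-! ### The maps `trivialPart` and `parallelPart` -/

namespace PathAlgebra

variable {K : Type*} [Field K] {V : Type*} [Quiver V]

section LinearMaps

open Classical in
/-- The linear map sending the trivial path at `i` to `k i • 1` and nontrivial paths to zero. -/
noncomputable def trivialPart [Fintype V] (k : V → K) : PathAlgebra K V →ₗ[K] PathAlgebra K V :=
  (basis K V).constr K fun p => if p.IsNontrivial then 0 else k p.src • 1

theorem trivialPart_of_isNontrivial [Fintype V] (k : V → K) {p : QPath V} (hp : p.IsNontrivial) :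
    trivialPart k (ofPath K p) = 0 := by
  rw [trivialPart, ← basis_apply, Module.Basis.constr_basis, if_pos hp]

theorem trivialPart_triv [Fintype V] (k : V → K) (i : V) :
    trivialPart k (ofPath K (QPath.triv i)) = k i • 1 := by
  rw [trivialPart, ← basis_apply, Module.Basis.constr_basis,
    if_neg (QPath.not_isNontrivial_triv i)]
  rfl

/-- A commutator contains no trivial path, and the values of `trivialPart k` are central, so both
sides of the Lie derivation identity are zero. -/
theorem isLieDerivation_trivialPart [Fintype V] (k : V → K) :
    IsLieDerivation (trivialPart (K := K) (V := V) k) := by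
  have hcentral : ∀ a b : PathAlgebra K V, trivialPart k a * b = b * trivialPart k a := by
    intro a b
    induction a using induction_ofPath with
    | zero => simp
    | add x y hx hy => rw [map_add, add_mul, mul_add, hx, hy]
    | smul r p =>
      by_cases hp : p.IsNontrivial
      · simp [trivialPart_of_isNontrivial k hp]
      · rw [QPath.eq_triv_of_not_isNontrivial hp, map_smul, trivialPart_triv]
        simp
  have hswap : ∀ x y : QPath V, trivialPart k (ofPath K x * ofPath K y) =
      trivialPart k (ofPath K y * ofPath K x) := by
    have hzero : ∀ x y : QPath V, x.IsNontrivial →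
        trivialPart k (ofPath K x * ofPath K y) = 0 ∧
        trivialPart k (ofPath K y * ofPath K x) = 0 := by
      intro x y hx
      constructor
      · by_cases h : y.tgt = x.src
        · rw [ofPath_mul_of_eq _ _ h,
            trivialPart_of_isNontrivial _ (QPath.mul_isNontrivial_left h hx)]
        · rw [ofPath_mul_of_ne _ _ h, map_zero]
      · by_cases h : x.tgt = y.src
        · rw [ofPath_mul_of_eq _ _ h,
            trivialPart_of_isNontrivial _ (QPath.mul_isNontrivial_right h hx)]
        · rw [ofPath_mul_of_ne _ _ h, map_zero]
    intro x y
    by_cases hx : x.IsNontrivial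
    · rw [(hzero x y hx).1, (hzero x y hx).2]
    by_cases hy : y.IsNontrivial
    · rw [(hzero y x hy).1, (hzero y x hy).2]
    classical
    rw [QPath.eq_triv_of_not_isNontrivial hx, QPath.eq_triv_of_not_isNontrivial hy,
      ofPath_triv_mul, ofPath_mul_triv]
    rfl
  intro a b
  rw [hcentral, hcentral b, sub_self, sub_self, add_zero, map_sub, sub_eq_zero]
  induction a using induction_ofPath with
  | zero => simp
  | add x y hx hy => rw [add_mul, mul_add, map_add, map_add, hx, hy]
  | smul r p =>
    induction b using induction_ofPath with
    | zero => simp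
    | add x y hx hy => rw [add_mul, mul_add, map_add, map_add, hx, hy]
    | smul s q => simp only [smul_mul_assoc, mul_smul_comm, map_smul, hswap p q, smul_comm r s]

open Classical in
/-- The linear map killing the trivial paths and sending a nontrivial path `p` to the combination
of the paths `q` parallel to `p` with coefficients `c p q`. -/
noncomputable def parallelPart (c : QPath V → QPath V → K) :
    PathAlgebra K V →ₗ[K] PathAlgebra K V :=
  (basis K V).constr K fun p =>
    if p.IsNontrivial then ∑ᶠ q : Quiver.Path p.src p.tgt, c p ⟨_, _, q⟩ • ofPath K ⟨_, _, q⟩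
    else 0

theorem parallelPart_triv (c : QPath V → QPath V → K) (i : V) :
    parallelPart c (ofPath K (QPath.triv i)) = 0 := by
  rw [parallelPart, ← basis_apply, Module.Basis.constr_basis,
    if_neg (QPath.not_isNontrivial_triv i)]

theorem parallelPart_of_isNontrivial (c : QPath V → QPath V → K) {p : QPath V}
    (hp : p.IsNontrivial) : parallelPart c (ofPath K p) =
      ∑ᶠ q : Quiver.Path p.src p.tgt, c p ⟨_, _, q⟩ • ofPath K ⟨_, _, q⟩ := by
  rw [parallelPart, ← basis_apply, Module.Basis.constr_basis, if_pos hp]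

theorem finsum_parallel {M : Type*} [AddCommMonoid M] (p : QPath V) (f : QPath V → M) :
    (∑ᶠ (q : QPath V) (_ : q.Parallel p), f q) =
      ∑ᶠ q : Quiver.Path p.src p.tgt, f ⟨p.src, p.tgt, q⟩ := by
  have hinj : Function.Injective fun q : Quiver.Path p.src p.tgt => (⟨_, _, q⟩ : QPath V) := by
    intro q q' h
    simpa using h
  rw [← finsum_mem_range (f := f) hinj]
  refine finsum_congr fun q => ?_
  have : q.Parallel p ↔ q ∈ Set.range fun q : Quiver.Path p.src p.tgt => (⟨_, _, q⟩ : QPath V) := by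
    constructor
    · obtain ⟨i, j, q⟩ := q
      obtain ⟨i', j', p⟩ := p
      rintro ⟨rfl, rfl⟩
      exact ⟨q, rfl⟩
    · rintro ⟨q, rfl⟩
      exact ⟨rfl, rfl⟩
  rw [this]

end LinearMaps

/-- Collecting the terms of a linear combination of paths between two vertices that belong to the
same path. -/
theorem sum_smul_ofPath_fiberwise {i j : V} {α : Type*} [Fintype α] [Fintype (Quiver.Path i j)]
    (f : α → K) (g : α → Quiver.Path i j) :
    ∑ a, f a • ofPath K ⟨i, j, g a⟩ =
      ∑ w : Quiver.Path i j, (∑ᶠ (a : α) (_ : g a = w), f a) • ofPath K ⟨i, j, w⟩ := by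
  classical
  simp only [finsum_eq_if, finsum_eq_sum_of_fintype, Finset.sum_smul, ite_smul, zero_smul]
  rw [Finset.sum_comm]
  simp

theorem sum_smul_ofPath_inj {i j : V} [Fintype (Quiver.Path i j)] {f g : Quiver.Path i j → K} :
    ∑ w, f w • ofPath K ⟨i, j, w⟩ = ∑ w, g w • ofPath K ⟨i, j, w⟩ ↔ f = g := by
  refine ⟨fun h => funext fun w => ?_, fun h => by rw [h]⟩
  classical
  simpa [coeff_ofPath] using congrArg (coeff K ⟨i, j, w⟩) h

section Finite

variable (K) in
theorem finite_path [FiniteDimensional K (PathAlgebra K V)] (i j : V) :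
    Finite (Quiver.Path i j) := by
  have := finite_qpath K V
  refine Finite.of_injective (fun q : Quiver.Path i j => (⟨i, j, q⟩ : QPath V)) ?_
  intro q q' h
  simpa using h

variable [FiniteDimensional K (PathAlgebra K V)]

/-- For two composable nontrivial paths, the Leibniz rule for `parallelPart c` is the second
condition on the coefficients. -/
theorem parallelPart_leibniz_iff [Fintype V] (c : QPath V → QPath V → K) {i j l : V}
    (y : Quiver.Path i j) (x : Quiver.Path j l) (hy : 0 < y.length) (hx : 0 < x.length) :
    parallelPart c (ofPath K ⟨i, l, y.comp x⟩) =
        parallelPart c (ofPath K ⟨j, l, x⟩) * ofPath K ⟨i, j, y⟩ +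
          ofPath K ⟨j, l, x⟩ * parallelPart c (ofPath K ⟨i, j, y⟩) ↔
      ∀ w : Quiver.Path i l, c ⟨i, l, y.comp x⟩ ⟨i, l, w⟩ =
        (∑ᶠ (q : Quiver.Path j l) (_ : y.comp q = w), c ⟨j, l, x⟩ ⟨j, l, q⟩) +
        (∑ᶠ (q : Quiver.Path i j) (_ : q.comp x = w), c ⟨i, j, y⟩ ⟨i, j, q⟩) := by
  have := fun i j : V => @Fintype.ofFinite _ (finite_path K i j)
  rw [parallelPart_of_isNontrivial c (p := ⟨j, l, x⟩) hx,
    parallelPart_of_isNontrivial c (p := ⟨i, j, y⟩) hy,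
    parallelPart_of_isNontrivial c (p := ⟨i, l, y.comp x⟩)
      (by simp [QPath.IsNontrivial, Quiver.Path.length_comp, hx])]
  simp only [finsum_eq_sum_of_fintype (α := Quiver.Path _ _) (M := PathAlgebra K V)]
  rw [Finset.sum_mul, Finset.mul_sum]
  have h₁ : ∀ q : Quiver.Path j l, ofPath K ⟨j, l, q⟩ * ofPath K ⟨i, j, y⟩ =
      ofPath K ⟨i, l, y.comp q⟩ := fun q => ofPath_mul_of_eq _ _ rfl
  have h₂ : ∀ q : Quiver.Path i j, ofPath K ⟨j, l, x⟩ * ofPath K ⟨i, j, q⟩ =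
      ofPath K ⟨i, l, q.comp x⟩ := fun q => ofPath_mul_of_eq _ _ rfl
  simp only [smul_mul_assoc, mul_smul_comm, h₁, h₂]
  rw [sum_smul_ofPath_fiberwise (fun q => c ⟨j, l, x⟩ ⟨j, l, q⟩) fun q => y.comp q,
    sum_smul_ofPath_fiberwise (fun q => c ⟨i, j, y⟩ ⟨i, j, q⟩) fun q => q.comp x,
    ← Finset.sum_add_distrib]
  simp only [← add_smul]
  rw [sum_smul_ofPath_inj, funext_iff]

theorem triv_mul_parallelPart [Fintype V] (c : QPath V → QPath V → K) (y : QPath V) :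
    ofPath K (QPath.triv y.tgt) * parallelPart c (ofPath K y) = parallelPart c (ofPath K y) := by
  have := fun i j : V => @Fintype.ofFinite _ (finite_path K i j)
  by_cases hy : y.IsNontrivial
  · rw [parallelPart_of_isNontrivial c hy, finsum_eq_sum_of_fintype, Finset.mul_sum]
    refine Finset.sum_congr rfl fun q _ => ?_
    rw [mul_smul_comm, ofPath_triv_mul, if_pos rfl]
  · rw [QPath.eq_triv_of_not_isNontrivial hy, parallelPart_triv, mul_zero]

theorem parallelPart_mul_triv [Fintype V] (c : QPath V → QPath V → K) (x : QPath V) :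
    parallelPart c (ofPath K x) * ofPath K (QPath.triv x.src) = parallelPart c (ofPath K x) := by
  have := fun i j : V => @Fintype.ofFinite _ (finite_path K i j)
  by_cases hx : x.IsNontrivial
  · rw [parallelPart_of_isNontrivial c hx, finsum_eq_sum_of_fintype, Finset.sum_mul]
    refine Finset.sum_congr rfl fun q _ => ?_
    rw [smul_mul_assoc, ofPath_mul_triv, if_pos rfl]
  · rw [QPath.eq_triv_of_not_isNontrivial hx, parallelPart_triv, zero_mul]

theorem parallelPart_mul_eq_zero [Fintype V] (c : QPath V → QPath V → K) {x y : QPath V}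
    (h : y.tgt ≠ x.src) : parallelPart c (ofPath K x) * ofPath K y = 0 := by
  rw [← parallelPart_mul_triv, mul_assoc, ofPath_mul_of_ne (QPath.triv x.src) y h, mul_zero]

theorem mul_parallelPart_eq_zero [Fintype V] (c : QPath V → QPath V → K) {x y : QPath V}
    (h : y.tgt ≠ x.src) : ofPath K x * parallelPart c (ofPath K y) = 0 := by
  rw [← triv_mul_parallelPart, ← mul_assoc, ofPath_mul_of_ne x (QPath.triv y.tgt) h, zero_mul]

theorem parallelPart_leibniz [Fintype V] {c : QPath V → QPath V → K} (hc : IsDerivationCoeff c)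
    (a b : PathAlgebra K V) :
    parallelPart c (a * b) = parallelPart c a * b + a * parallelPart c b := by
  classical
  induction a using induction_ofPath with
  | zero => simp
  | add x y hx hy => rw [add_mul, map_add, hx, hy, map_add, add_mul, add_mul]; abel
  | smul r x =>
  induction b using induction_ofPath with
  | zero => simp
  | add x y hx hy => rw [mul_add, map_add, hx, hy, map_add, mul_add, mul_add]; abel
  | smul s y =>
    suffices h : parallelPart c (ofPath K x * ofPath K y) =
        parallelPart c (ofPath K x) * ofPath K y + ofPath K x * parallelPart c (ofPath K y) by
      simp only [smul_mul_assoc, mul_smul_comm, map_smul, h, smul_add]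
    by_cases h : y.tgt = x.src
    · by_cases hx : x.IsNontrivial
      · by_cases hy : y.IsNontrivial
        · obtain ⟨j, l, x⟩ := x
          obtain ⟨i, j', y⟩ := y
          obtain rfl : j' = j := h
          rw [ofPath_mul_of_eq _ _ rfl]
          exact (parallelPart_leibniz_iff c y x hy hx).2 fun w => hc.path _ _ _ y x w hy hx
        · have hy' := QPath.eq_triv_of_not_isNontrivial hy
          have hs : y = QPath.triv x.src := by
            rw [hy'] at h ⊢
            rw [← h]
            rfl
          rw [hs, parallelPart_mul_triv, parallelPart_triv, ofPath_mul_triv, if_pos rfl, mul_zero,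
            add_zero]
      · have hs : x = QPath.triv y.tgt := by
          rw [h]
          exact QPath.eq_triv_of_not_isNontrivial hx
        rw [hs, triv_mul_parallelPart, parallelPart_triv, ofPath_triv_mul, if_pos rfl, zero_mul,
          zero_add]
    · rw [ofPath_mul_of_ne _ _ h, parallelPart_mul_eq_zero c h, mul_parallelPart_eq_zero c h,
        map_zero, add_zero]

end Finite

end PathAlgebra

/-! ### The inner derivation attached to the coefficients -/

theorem finsum_prop_eq_sum_ite {α M : Type*} [Fintype α] [AddCommMonoid M] (P : α → Prop)
    [DecidablePred P] (f : α → M) :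
    (∑ᶠ (a : α) (_ : P a), f a) = ∑ a, if P a then f a else 0 := by
  simp only [finsum_eq_if, finsum_eq_sum_of_fintype]

namespace PathAlgebra

variable {K : Type*} [Field K] {V : Type*} [Quiver V]

theorem coeff_one_triv [Fintype V] (j : V) : coeff K (QPath.triv j) 1 = 1 := by
  classical
  have h := coeff_self_mul_ofPath (K := K) (QPath.triv j) 1
  rw [one_mul, coeff_ofPath, if_pos rfl] at h
  exact h.symm

theorem coeff_one_of_ne [Fintype V] {q : QPath V} (hq : q.src ≠ q.tgt) : coeff K q 1 = 0 := by
  classical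
  rw [one_def, map_sum]
  refine Finset.sum_eq_zero fun i _ => ?_
  rw [coeff_ofPath, if_neg]
  rintro rfl
  exact hq rfl

/-- The combination of the paths `q` with distinct endpoints whose coefficients are those attached
by `c` to the start of `q`. -/
noncomputable def innerElement (c : QPath V → QPath V → K) : PathAlgebra K V :=
  ∑ᶠ (q : QPath V) (_ : q.src ≠ q.tgt), c (QPath.triv q.src) q • ofPath K q

section Finite

variable [FiniteDimensional K (PathAlgebra K V)]

theorem coeff_innerElement [DecidableEq V] (c : QPath V → QPath V → K) (q : QPath V) :
    coeff K q (innerElement c) = if q.src ≠ q.tgt then c (QPath.triv q.src) q else 0 := by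
  classical
  have := @Fintype.ofFinite _ (finite_qpath K V)
  rw [innerElement, finsum_prop_eq_sum_ite, map_sum, Finset.sum_eq_single q]
  · split_ifs <;> simp [coeff_ofPath]
  · intro p _ hp
    split_ifs <;> simp [coeff_ofPath, hp]
  · simp

variable [Fintype V]

theorem innerDerivation_innerElement_triv {c : QPath V → QPath V → K}
    (hc : ∀ q : QPath V, q.src ≠ q.tgt →
      c (QPath.triv q.src) q + c (QPath.triv q.tgt) q = 0) (i : V) :
    innerDerivation K (innerElement c) (ofPath K (QPath.triv i)) =
      ∑ᶠ (q : QPath V) (_ : q.src ≠ q.tgt ∧ (q.src = i ∨ q.tgt = i)),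
        c (QPath.triv i) q • ofPath K q := by
  classical
  have := @Fintype.ofFinite _ (finite_qpath K V)
  rw [innerDerivation_apply, innerElement, finsum_prop_eq_sum_ite, finsum_prop_eq_sum_ite,
    Finset.sum_mul, Finset.mul_sum, ← Finset.sum_sub_distrib]
  refine Finset.sum_congr rfl fun q _ => ?_
  by_cases hq : q.src = q.tgt
  · simp [hq]
  · have h := eq_neg_of_add_eq_zero_left (hc q hq)
    simp only [ne_eq, hq, not_false_eq_true, if_true, true_and, smul_mul_assoc, mul_smul_comm,
      ofPath_mul_triv, ofPath_triv_mul]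
    by_cases hs : q.src = i
    · have ht : q.tgt ≠ i := fun ht => hq (hs.trans ht.symm)
      simp [hs, ht]
    · by_cases ht : q.tgt = i
      · rw [← ht] at hs ⊢
        simp [hs, h]
      · simp [hs, ht]

theorem innerDerivation_innerElement_ofPath {c : QPath V → QPath V → K}
    (hc : ∀ q : QPath V, q.src ≠ q.tgt →
      c (QPath.triv q.src) q + c (QPath.triv q.tgt) q = 0) (p : QPath V) :
    innerDerivation K (innerElement c) (ofPath K p) =
      (∑ᶠ (q : QPath V) (_ : q.src ≠ q.tgt ∧ q.tgt = p.src),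
        c (QPath.triv p.src) q • (ofPath K p * ofPath K q)) +
      (∑ᶠ (q : QPath V) (_ : q.src ≠ q.tgt ∧ q.src = p.tgt),
        c (QPath.triv p.tgt) q • (ofPath K q * ofPath K p)) := by
  classical
  have := @Fintype.ofFinite _ (finite_qpath K V)
  rw [innerDerivation_apply, innerElement, finsum_prop_eq_sum_ite, finsum_prop_eq_sum_ite,
    finsum_prop_eq_sum_ite, Finset.sum_mul, Finset.mul_sum, sub_eq_neg_add,
    ← Finset.sum_neg_distrib]
  congr 1
  · refine Finset.sum_congr rfl fun q _ => ?_
    by_cases hq : q.src = q.tgt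
    · simp [hq]
    · have h := eq_neg_of_add_eq_zero_left (hc q hq)
      by_cases ht : q.tgt = p.src
      · rw [if_pos hq, if_pos ⟨hq, ht⟩, h, ht]
        simp
      · simp [hq, ht, ofPath_mul_of_ne _ _ ht]
  · refine Finset.sum_congr rfl fun q _ => ?_
    by_cases hq : q.src = q.tgt
    · simp [hq]
    · by_cases hs : q.src = p.tgt
      · rw [if_pos hq, if_pos ⟨hq, hs⟩, hs, smul_mul_assoc]
      · simp [hq, hs, ofPath_mul_of_ne q p (Ne.symm hs)]

/-- The formulas on the trivial and on the nontrivial paths say that `Θ` is the sum of a map with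
central values on the trivial paths, an inner derivation, and a map preserving endpoints. -/
theorem forall_ofPath_eq_iff {c : QPath V → QPath V → K}
    (hc : ∀ q : QPath V, q.src ≠ q.tgt →
      c (QPath.triv q.src) q + c (QPath.triv q.tgt) q = 0) (k : V → K)
    (Θ : PathAlgebra K V →ₗ[K] PathAlgebra K V) :
    ((∀ i : V, Θ (ofPath K (QPath.triv i)) =
          k i • (1 : PathAlgebra K V) +
            ∑ᶠ (q : QPath V) (_ : q.src ≠ q.tgt ∧ (q.src = i ∨ q.tgt = i)),
              c (QPath.triv i) q • ofPath K q) ∧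
        (∀ p : QPath V, p.IsNontrivial → Θ (ofPath K p) =
          (∑ᶠ (q : QPath V) (_ : q.src ≠ q.tgt ∧ q.tgt = p.src),
            c (QPath.triv p.src) q • (ofPath K p * ofPath K q)) +
          (∑ᶠ (q : QPath V) (_ : q.Parallel p), c p q • ofPath K q) +
          (∑ᶠ (q : QPath V) (_ : q.src ≠ q.tgt ∧ q.src = p.tgt),
            c (QPath.triv p.tgt) q • (ofPath K q * ofPath K p)))) ↔
      Θ = trivialPart k + innerDerivation K (innerElement c) + parallelPart c := by
  have htriv : ∀ i, (trivialPart k + innerDerivation K (innerElement c) + parallelPart c)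
      (ofPath K (QPath.triv i)) = k i • (1 : PathAlgebra K V) +
        ∑ᶠ (q : QPath V) (_ : q.src ≠ q.tgt ∧ (q.src = i ∨ q.tgt = i)),
          c (QPath.triv i) q • ofPath K q := fun i => by
    rw [LinearMap.add_apply, LinearMap.add_apply, trivialPart_triv, parallelPart_triv, add_zero,
      innerDerivation_innerElement_triv hc]
  have hpath : ∀ p : QPath V, p.IsNontrivial →
      (trivialPart k + innerDerivation K (innerElement c) + parallelPart c) (ofPath K p) =
        (∑ᶠ (q : QPath V) (_ : q.src ≠ q.tgt ∧ q.tgt = p.src),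
          c (QPath.triv p.src) q • (ofPath K p * ofPath K q)) +
        (∑ᶠ (q : QPath V) (_ : q.Parallel p), c p q • ofPath K q) +
        (∑ᶠ (q : QPath V) (_ : q.src ≠ q.tgt ∧ q.src = p.tgt),
          c (QPath.triv p.tgt) q • (ofPath K q * ofPath K p)) := fun p hp => by
    rw [LinearMap.add_apply, LinearMap.add_apply, trivialPart_of_isNontrivial k hp, zero_add,
      parallelPart_of_isNontrivial c hp, innerDerivation_innerElement_ofPath hc,
      finsum_parallel p fun q => c p q • ofPath K q, add_right_comm]
  constructor
  · rintro ⟨h₁, h₂⟩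
    refine linearMap_ext fun p => ?_
    by_cases hp : p.IsNontrivial
    · rw [h₂ p hp, hpath p hp]
    · rw [QPath.eq_triv_of_not_isNontrivial hp, h₁, htriv]
  · rintro rfl
    exact ⟨htriv, hpath⟩

theorem path_of_isLieDerivation_parallelPart (hacyc : Quiver.NoOrientedCycles V)
    {c : QPath V → QPath V → K} (h : IsLieDerivation (parallelPart c)) (i j l : V)
    (y : Quiver.Path i j) (x : Quiver.Path j l) (w : Quiver.Path i l)
    (hy : 0 < y.length) (hx : 0 < x.length) :
    c ⟨i, l, y.comp x⟩ ⟨i, l, w⟩ =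
      (∑ᶠ (q : Quiver.Path j l) (_ : y.comp q = w), c ⟨j, l, x⟩ ⟨j, l, q⟩) +
      (∑ᶠ (q : Quiver.Path i j) (_ : q.comp x = w), c ⟨i, j, y⟩ ⟨i, j, q⟩) := by
  refine (parallelPart_leibniz_iff c y x hy hx).1 ?_ w
  -- Without oriented cycles `x y` is the commutator of `x` and `y`.
  have hne : (⟨j, l, x⟩ : QPath V).tgt ≠ (⟨i, j, y⟩ : QPath V).src :=
    QPath.tgt_ne_src_of_composable hacyc rfl hx
  have hxy : ofPath K ⟨j, l, x⟩ * ofPath K ⟨i, j, y⟩ = ofPath K ⟨i, l, y.comp x⟩ :=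
    ofPath_mul_of_eq _ _ rfl
  have := h (ofPath K ⟨j, l, x⟩) (ofPath K ⟨i, j, y⟩)
  rwa [hxy, ofPath_mul_of_ne _ _ hne, parallelPart_mul_eq_zero c hne,
    mul_parallelPart_eq_zero c hne, sub_zero, sub_zero, sub_zero] at this

end Finite

/-! ### The coefficients of a Lie derivation -/

section LieDerivation

variable [Fintype V] {Θ : PathAlgebra K V →ₗ[K] PathAlgebra K V}

/-- The identity obtained from `[e_i, e_j] = 0`, for the coefficient of a path `q`. -/
theorem coeff_triv_triv [DecidableEq V] (h : IsLieDerivation Θ) {i j : V} (hij : i ≠ j)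
    (q : QPath V) :
    (((if q.src = j then coeff K q (Θ (ofPath K (QPath.triv i))) else 0) -
      (if q.tgt = j then coeff K q (Θ (ofPath K (QPath.triv i))) else 0)) +
     ((if q.tgt = i then coeff K q (Θ (ofPath K (QPath.triv j))) else 0) -
      (if q.src = i then coeff K q (Θ (ofPath K (QPath.triv j))) else 0))) = 0 := by
  have := congrArg (coeff K q) (h (ofPath K (QPath.triv i)) (ofPath K (QPath.triv j)))
  rw [ofPath_mul_of_ne _ _ (Ne.symm hij), ofPath_mul_of_ne _ _ hij, sub_zero, map_zero, map_zero,
    map_add, map_sub, map_sub, coeff_mul_triv, coeff_triv_mul, coeff_triv_mul,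
    coeff_mul_triv] at this
  exact this.symm

theorem coeff_triv_src_add_coeff_triv_tgt (h : IsLieDerivation Θ) {q : QPath V}
    (hq : q.src ≠ q.tgt) : coeff K q (Θ (ofPath K (QPath.triv q.src))) +
      coeff K q (Θ (ofPath K (QPath.triv q.tgt))) = 0 := by
  classical
  have := coeff_triv_triv h hq q
  simp only [hq, hq.symm, if_true, if_false] at this
  linear_combination -this

theorem coeff_triv_eq_zero (h : IsLieDerivation Θ) {q : QPath V} (hq : q.src ≠ q.tgt) {i : V}
    (hs : q.src ≠ i) (ht : q.tgt ≠ i) : coeff K q (Θ (ofPath K (QPath.triv i))) = 0 := by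
  classical
  have := coeff_triv_triv h hs.symm q
  simpa [hq.symm, hs, ht] using this

/-- The coefficients of `Θ e_i` at the trivial paths agree at the endpoints of an arrow `a`: compare
the coefficients of `a` in the identity for `[e_i, a]`, which is a multiple of `a`. -/
theorem coeff_triv_eq_of_hom (h : IsLieDerivation Θ) (i : V) {s t : V} (a : s ⟶ t) :
    coeff K (QPath.triv s) (Θ (ofPath K (QPath.triv i))) =
      coeff K (QPath.triv t) (Θ (ofPath K (QPath.triv i))) := by
  classical
  have := congrArg (coeff K ⟨s, t, a.toPath⟩)
    (h (ofPath K (QPath.triv i)) (ofPath K ⟨s, t, a.toPath⟩))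
  rw [map_add, map_sub, map_sub, map_sub, map_sub, coeff_triv_mul, coeff_mul_triv,
    coeff_self_mul_ofPath, coeff_self_ofPath_mul, ofPath_triv_mul, ofPath_mul_triv] at this
  have h' : ∀ {P : Prop} [Decidable P] (b : PathAlgebra K V),
      coeff K ⟨s, t, a.toPath⟩ (Θ (if P then b else 0)) =
        if P then coeff K ⟨s, t, a.toPath⟩ (Θ b) else 0 := fun b => by split_ifs <;> simp
  rw [h', h'] at this
  linear_combination this

/-- A Lie derivation killing the trivial paths preserves the endpoints of nontrivial paths. -/
theorem parallel_of_coeff_ne_zero (hacyc : Quiver.NoOrientedCycles V) (h : IsLieDerivation Θ)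
    (h0 : ∀ i, Θ (ofPath K (QPath.triv i)) = 0) {p q : QPath V} (hp : p.IsNontrivial)
    (hq : coeff K q (Θ (ofPath K p)) ≠ 0) : q.Parallel p := by
  classical
  have hne := hacyc p hp
  have key : ∀ i, coeff K q (Θ (ofPath K (QPath.triv i) * ofPath K p -
      ofPath K p * ofPath K (QPath.triv i))) =
      (if q.tgt = i then coeff K q (Θ (ofPath K p)) else 0) -
        (if q.src = i then coeff K q (Θ (ofPath K p)) else 0) := fun i => by
    rw [h, h0, zero_mul, mul_zero, sub_zero, zero_add, map_sub, coeff_triv_mul, coeff_mul_triv]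
  have ht := key p.tgt
  have hs := key p.src
  rw [ofPath_triv_mul, ofPath_mul_triv, if_pos rfl, if_neg hne, sub_zero] at ht
  rw [ofPath_triv_mul, ofPath_mul_triv, if_pos rfl, if_neg hne.symm, zero_sub, map_neg,
    map_neg] at hs
  by_cases h₁ : q.tgt = p.tgt
  · refine ⟨?_, h₁⟩
    by_contra h₂
    rw [if_neg h₂, if_neg (h₁ ▸ hne.symm), sub_zero] at hs
    exact hq (neg_eq_zero.1 hs)
  · -- In characteristic two the endpoints of `q` could a priori be interchanged, but then `q`
    -- followed by `p` would be an oriented cycle.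
    exfalso
    have h₂ : q.src = p.tgt := by
      by_contra h₂
      rw [if_neg h₁, if_neg h₂, sub_zero] at ht
      exact hq ht
    have h₃ : q.tgt = p.src := by
      by_contra h₃
      rw [if_neg h₃, if_neg (h₂ ▸ hne.symm), sub_zero] at hs
      exact hq (neg_eq_zero.1 hs)
    exact QPath.tgt_ne_src_of_composable hacyc h₃ hp h₂.symm

theorem eq_parallelPart [FiniteDimensional K (PathAlgebra K V)]
    (hacyc : Quiver.NoOrientedCycles V) (h : IsLieDerivation Θ)
    (h0 : ∀ i, Θ (ofPath K (QPath.triv i)) = 0) {c : QPath V → QPath V → K}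
    (hc : ∀ p q : QPath V, p.IsNontrivial → c p q = coeff K q (Θ (ofPath K p))) :
    Θ = parallelPart c := by
  classical
  have := @Fintype.ofFinite _ (finite_qpath K V)
  refine linearMap_ext fun p => ?_
  by_cases hp : p.IsNontrivial
  · rw [parallelPart_of_isNontrivial c hp, ← finsum_parallel p fun q => c p q • ofPath K q,
      finsum_prop_eq_sum_ite, ← sum_coeff_smul (Θ (ofPath K p))]
    refine Finset.sum_congr rfl fun q _ => ?_
    split_ifs with hq
    · rw [hc p q hp]
    · rw [not_imp_comm.1 (parallel_of_coeff_ne_zero hacyc h h0 hp) hq, zero_smul]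
  · rw [QPath.eq_triv_of_not_isNontrivial hp, h0, parallelPart_triv]

/-- A Lie derivation agrees on the trivial paths with an inner derivation up to scalars. -/
theorem apply_triv_eq [FiniteDimensional K (PathAlgebra K V)] (hconn : Quiver.IsWeaklyConnected V)
    (hacyc : Quiver.NoOrientedCycles V) (h : IsLieDerivation Θ) (i : V) :
    Θ (ofPath K (QPath.triv i)) =
      coeff K (QPath.triv i) (Θ (ofPath K (QPath.triv i))) • (1 : PathAlgebra K V) +
        innerDerivation K (innerElement fun p q => coeff K q (Θ (ofPath K p)))
          (ofPath K (QPath.triv i)) := by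
  classical
  refine ext_coeff fun q => ?_
  rw [map_add, map_smul, innerDerivation_apply, map_sub, coeff_mul_triv, coeff_triv_mul,
    coeff_innerElement, smul_eq_mul]
  by_cases hq : q.src = q.tgt
  · have hq' := QPath.eq_triv_of_not_isNontrivial fun hn => hacyc q hn hq
    rw [hq', coeff_one_triv,
      hconn.eq_of_forall_hom (f := fun j => coeff K (QPath.triv j) (Θ (ofPath K (QPath.triv i))))
        (coeff_triv_eq_of_hom h i) q.src i]
    simp [QPath.triv]
  · rw [coeff_one_of_ne hq, if_pos hq, mul_zero, zero_add]
    by_cases hs : q.src = i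
    · subst hs
      rw [if_pos rfl, if_neg (Ne.symm hq), sub_zero]
    · by_cases ht : q.tgt = i
      · subst ht
        rw [if_neg hs, if_pos rfl, zero_sub]
        exact eq_neg_of_add_eq_zero_right (coeff_triv_src_add_coeff_triv_tgt h hq)
      · rw [if_neg hs, if_neg ht, sub_zero, coeff_triv_eq_zero h hq hs ht]

end LieDerivation

end PathAlgebra

/-! ### The characterization -/

open PathAlgebra in
theorem theorem4p8 (K : Type*) [Field K] (V : Type*) [Fintype V] [Quiver V]
    (hconn : Quiver.IsWeaklyConnected V) (hacyc : Quiver.NoOrientedCycles V)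
    [FiniteDimensional K (PathAlgebra K V)]
    (Θ : PathAlgebra K V →ₗ[K] PathAlgebra K V) :
    IsLieDerivation Θ ↔
      ∃ (k : V → K) (c : QPath V → QPath V → K), IsDerivationCoeff c ∧
        (∀ i : V, Θ (ofPath K (QPath.triv i)) =
          k i • (1 : PathAlgebra K V) +
            ∑ᶠ (q : QPath V) (_ : q.src ≠ q.tgt ∧ (q.src = i ∨ q.tgt = i)),
              c (QPath.triv i) q • ofPath K q) ∧
        (∀ p : QPath V, p.IsNontrivial → Θ (ofPath K p) =
          (∑ᶠ (q : QPath V) (_ : q.src ≠ q.tgt ∧ q.tgt = p.src),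
            c (QPath.triv p.src) q • (ofPath K p * ofPath K q)) +
          (∑ᶠ (q : QPath V) (_ : q.Parallel p), c p q • ofPath K q) +
          (∑ᶠ (q : QPath V) (_ : q.src ≠ q.tgt ∧ q.src = p.tgt),
            c (QPath.triv p.tgt) q • (ofPath K q * ofPath K p))) := by
  classical
  constructor
  · intro h
    let u : PathAlgebra K V := innerElement fun p q => coeff K q (Θ (ofPath K p))
    let k : V → K := fun i => coeff K (QPath.triv i) (Θ (ofPath K (QPath.triv i)))
    let Φ := Θ - (trivialPart k + innerDerivation K u)
    have hΦ : IsLieDerivation Φ :=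
      h.sub ((isLieDerivation_trivialPart k).add (isLieDerivation_innerDerivation u))
    have hΦ0 : ∀ i, Φ (ofPath K (QPath.triv i)) = 0 := fun i => by
      rw [LinearMap.sub_apply, LinearMap.add_apply, trivialPart_triv, sub_eq_zero]
      exact apply_triv_eq hconn hacyc h i
    -- On the trivial paths the coefficients are those of `Θ`, on the others those of `Φ`.
    let c : QPath V → QPath V → K := fun p q =>
      if p.IsNontrivial then coeff K q (Φ (ofPath K p)) else coeff K q (Θ (ofPath K p))
    have hctriv : ∀ i q, c (QPath.triv i) q = coeff K q (Θ (ofPath K (QPath.triv i))) :=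
      fun i q => if_neg (QPath.not_isNontrivial_triv i)
    have hcu : innerElement c = u := by simp only [innerElement, hctriv, u]
    have hΦc : Φ = parallelPart c := eq_parallelPart hacyc hΦ hΦ0 fun p q hp => if_pos hp
    have hc : IsDerivationCoeff c :=
      { vertex := fun q hq => by
          rw [hctriv, hctriv]
          exact coeff_triv_src_add_coeff_triv_tgt h hq
        path := path_of_isLieDerivation_parallelPart hacyc (hΦc ▸ hΦ) }
    refine ⟨k, c, hc, (forall_ofPath_eq_iff hc.vertex k Θ).2 ?_⟩
    rw [hcu, ← hΦc, add_sub_cancel]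
  · rintro ⟨k, c, hc, hΘ⟩
    rw [(forall_ofPath_eq_iff hc.vertex k Θ).1 hΘ]
    exact ((isLieDerivation_trivialPart k).add (isLieDerivation_innerDerivation _)).add
      (isLieDerivation_of_leibniz (parallelPart_leibniz hc))
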